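/- Let $A$ and $B$ be fixed finitely generated abelian groups, written additively. Let $A\wr B$ be their restricted wreath product: its elements are the pairs $(\delta,f)$ with $\delta\in B$ (the $B$-component) and $f\colon B\to A$ of finite support (the values of $f$ are the lamp values), with multiplication $(\delta_1,f_1)(\delta_2,f_2)=(\delta_1+\delta_2,\,f_1^{\delta_2}+f_2)$, where $f^{b}(x)=f(b+x)$. Let $\operatorname{rank}(B)$ be the minimal number of generators of $B$. Consider orientable quadratic equations in standard form $$\prod_{i=1}^g[x_i,y_i]\;\prod_{j=1}^m z_j^{-1}c_jz_j=1 \qquad (*)$$ over $A\wr B$, with variables $x_i,y_i,z_j$, constants $c_j=(\delta_j,f_j)\in A\wr B$, $[x,y]=x^{-1}y^{-1}xy$, any $m\ge 0$, and genus $g\ge 0$ satisfying $g\ge \operatorname{rank}(B)/2$; solutions are sought in $A\wr B$. 1. The Diophantine problem for this class is in $\mathbf{P}$: for any finite generating families $a_1,\dots,a_n$ of $A$ and $b_1,\dots,b_k$ of $B$, if the constants are given as words in $a_1^{\pm1},\dots,a_n^{\pm1},b_1^{\pm1},\dots,b_k^{\pm1}$ (where $a\in A$ stands for $(0,f)$ with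 $f(0)=a$ and $f(x)=0$ for $x\ne0$, and $b\in B$ stands for $(b,0)$), then it is decidable in time polynomial in the length of the left-hand side of $(*)$ whether a given equation $(*)$ of the class, with $g$ and $m$ part of the input, has a solution. 2. An equation $(*)$ with $g\ge \operatorname{rank}(B)/2$ has a solution if and only if $$\sum_{j=1}^m\delta_j=0 \text{ in } B\qquad\text{and}\qquad \sum_{j=1}^m\ \sum_{x\in\operatorname{supp}(f_j)}f_j(x)=0 \text{ in } A .$$ -/

import Mathlib

universe u v

/-- The restricted wreath product `A ≀ B` of two groups written additively: pairs `(δ, f)` with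
`δ ∈ B` (the `B`-component) and `f : B → A` of finite support (the lamps). -/
@[ext]
structure RestrictedWreath (A : Type u) (B : Type v) [AddCommGroup A] [AddCommGroup B] where
  base : B
  lamp : B →₀ A

namespace RestrictedWreath

variable {A : Type u} {B : Type v} [AddCommGroup A] [AddCommGroup B]

/-- The right action of `B` on finitely supported functions: `f ^ b = (x ↦ f (b + x))`. -/
noncomputable def shift (f : B →₀ A) (b : B) : B →₀ A :=
  f.comapDomain (fun x => b + x) (add_right_injective b).injOn

@[simp]
theorem shift_apply (f : B →₀ A) (b x : B) : shift f b x = f (b + x) := rfl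

/-- `(δ₁, f₁) (δ₂, f₂) = (δ₁ + δ₂, f₁ ^ δ₂ + f₂)`. -/
noncomputable instance : Mul (RestrictedWreath A B) :=
  ⟨fun p q => ⟨p.base + q.base, shift p.lamp q.base + q.lamp⟩⟩

noncomputable instance : One (RestrictedWreath A B) := ⟨⟨0, 0⟩⟩

noncomputable instance : Inv (RestrictedWreath A B) :=
  ⟨fun p => ⟨-p.base, -shift p.lamp (-p.base)⟩⟩

@[simp] theorem mul_base (p q : RestrictedWreath A B) : (p * q).base = p.base + q.base := rfl
@[simp] theorem mul_lamp (p q : RestrictedWreath A B) :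
    (p * q).lamp = shift p.lamp q.base + q.lamp := rfl
@[simp] theorem one_base : (1 : RestrictedWreath A B).base = 0 := rfl
@[simp] theorem one_lamp : (1 : RestrictedWreath A B).lamp = 0 := rfl
@[simp] theorem inv_base (p : RestrictedWreath A B) : p⁻¹.base = -p.base := rfl
@[simp] theorem inv_lamp (p : RestrictedWreath A B) :
    p⁻¹.lamp = -shift p.lamp (-p.base) := rfl

noncomputable instance : Group (RestrictedWreath A B) :=
  Group.ofLeftAxioms
    (fun p q r => by
      ext x
      · simp [add_assoc]
      · simp [add_assoc])
    (fun p => by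
      ext x
      · simp
      · simp)
    (fun p => by
      ext x
      · simp
      · simp)

/-- The copy of `a ∈ A` in `A ≀ B`: the single lamp `a` at `0`. -/
noncomputable def ofLamp (a : A) : RestrictedWreath A B := ⟨0, Finsupp.single 0 a⟩

/-- The copy of `b ∈ B` in `A ≀ B`. -/
noncomputable def ofBase (b : B) : RestrictedWreath A B := ⟨b, 0⟩

/-- The sum in `A` of all lamp values of an element. -/
noncomputable def lampSum (p : RestrictedWreath A B) : A := p.lamp.sum fun _ a => a

end RestrictedWreath

/-- A countable supply of variables for equations. -/
inductive EqVar
  | x (i : ℕ)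
  | y (i : ℕ)
  | z (i : ℕ)

section Equations

variable {G : Type*} [Group G]

/-- The equation `W = 1` has a solution in `G`: some homomorphism `F * G → G` that is the identity
on `G` kills `W`, where `F` is the free group on the variables. -/
def HasSolution (W : Monoid.Coprod (FreeGroup EqVar) G) : Prop :=
  ∃ φ : Monoid.Coprod (FreeGroup EqVar) G →* G,
    φ.comp Monoid.Coprod.inr = MonoidHom.id G ∧ φ W = 1

/-- A variable as an element of `F * G`. -/
def varElem (G : Type*) [Group G] (t : EqVar) : Monoid.Coprod (FreeGroup EqVar) G :=
  Monoid.Coprod.inl (FreeGroup.of t)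

/-- `∏_{i<g} [x i, y i] · ∏_{j<m} (z j)⁻¹ (c j) (z j)`, an element of `F * G`, where
`[x, y] = x⁻¹ y⁻¹ x y`. -/
def orientableWord (g : ℕ) {m : ℕ} (c : Fin m → G) : Monoid.Coprod (FreeGroup EqVar) G :=
  (List.ofFn fun i : Fin g =>
      (varElem G (.x i))⁻¹ * (varElem G (.y i))⁻¹ * varElem G (.x i) * varElem G (.y i)).prod *
  (List.ofFn fun j : Fin m =>
      (varElem G (.z j))⁻¹ * Monoid.Coprod.inr (c j) * varElem G (.z j)).prod

end Equations

/-- The alphabet `a₁^{±1}, …, aₙ^{±1}, b₁^{±1}, …, bₖ^{±1}`; the Boolean is `true` for a generator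
and `false` for its inverse. -/
abbrev WreathLetter (n k : ℕ) : Type := (Fin n ⊕ Fin k) × Bool

/-- The element of `A ≀ B` that a letter stands for. -/
noncomputable def letterValue {A : Type u} {B : Type v} [AddCommGroup A] [AddCommGroup B]
    {n k : ℕ} (a : Fin n → A) (b : Fin k → B) (l : WreathLetter n k) : RestrictedWreath A B :=
  let s : RestrictedWreath A B :=
    Sum.elim (fun i => RestrictedWreath.ofLamp (a i)) (fun j => RestrictedWreath.ofBase (b j)) l.1
  if l.2 then s else s⁻¹

/-- The element of `A ≀ B` that a word stands for. -/
noncomputable def wordValue {A : Type u} {B : Type v} [AddCommGroup A] [AddCommGroup B]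
    {n k : ℕ} (a : Fin n → A) (b : Fin k → B) (w : List (WreathLetter n k)) :
    RestrictedWreath A B :=
  (w.map (letterValue a b)).prod

/-- An orientable equation in standard form whose constants are given as words. -/
structure OrientableInput (n k : ℕ) where
  genus : ℕ
  numConst : ℕ
  const : Fin numConst → List (WreathLetter n k)

/-- The symbols in which equations are written: variables `x`, `y`, `z` (`true`) and their inverses
(`false`), and letters of constants. -/
inductive EqSymbol (n k : ℕ)
  | x (sign : Bool)
  | y (sign : Bool)
  | z (sign : Bool)
  | letter (l : WreathLetter n k)

namespace OrientableInput

variable {n k : ℕ}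

/-- The string that represents an equation: its left-hand side
`(x⁻¹ y⁻¹ x y)^g (z⁻¹ c₁ z) ⋯ (z⁻¹ cₘ z)`, one symbol for each letter. The indices of the variables
are determined by their positions and are not written, so the length of the string is the length
`4 g + ∑ (|c_j| + 2)` of the left-hand side. -/
def encode (E : OrientableInput n k) : List (EqSymbol n k) :=
  (List.replicate E.genus
      [EqSymbol.x false, EqSymbol.y false, EqSymbol.x true, EqSymbol.y true]).flatten ++
  (List.ofFn fun j : Fin E.numConst =>
      EqSymbol.z false :: ((E.const j).map EqSymbol.letter ++ [EqSymbol.z true])).flatten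

/-- The equation over `A ≀ B` that the input describes has a solution in `A ≀ B`. -/
def Solvable {A : Type u} {B : Type v} [AddCommGroup A] [AddCommGroup B]
    (a : Fin n → A) (b : Fin k → B) (E : OrientableInput n k) : Prop :=
  HasSolution (orientableWord E.genus fun j => wordValue a b (E.const j))

end OrientableInput

/-- The language of the Diophantine problem over `A ≀ B`, with respect to the generators `a` of `A`
and `b` of `B`, for the orientable equations of genus `g ≥ rank(B) / 2`: the strings that represent
an equation of this class with a solution. Here `rank(B)` is the minimal number of generators. -/
def highGenusDP {A : Type u} {B : Type v} [AddCommGroup A] [AddCommGroup B] [AddGroup.FG B]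
    {n k : ℕ} (a : Fin n → A) (b : Fin k → B) : Set (List (EqSymbol n k)) :=
  {w | ∃ E : OrientableInput n k,
    E.encode = w ∧ (AddGroup.rank B : ℝ) / 2 ≤ E.genus ∧ E.Solvable a b}

open Classical in
/-- The complexity class `P`: a Turing machine decides the language in polynomial time, that is, it
computes the characteristic function within a number of steps that is polynomial in the length of
the string. -/
def InP {S : Type} (L : Set (List S)) : Prop :=
  Nonempty (Turing.TM2ComputableInPolyTime (id : List S → List S) Computability.encodeBool
    fun w => decide (w ∈ L))

open Turing StateTransition

/-! Solvability. The `B`-component and the lamp sum form a homomorphism `abelianized` to the abelian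
group `B × A`; it kills commutators and forgets conjugation, so both sums must vanish. Conversely,
take all `z j` trivial. The product of the constants is then a lamp configuration of total sum zero,
that is, an element of the augmentation part of `A[B]`, and `exists_sum_shift_sub_eq` writes it as a
sum of terms `h ^ b - h` with `b` running over any generating family. By `commutator_eq` one
commutator supplies two such terms for two freely chosen elements of `B`, so `g` handles suffice
once `2 g` elements generate `B`. This is `hasSolution_iff`.

Complexity. By this criterion the problem asks whether a string is well formed, whether its genus is
large enough, and whether a sum of letter weights in `B × A` is zero. The first two conditions are
regular. A finitely generated abelian group is a free group of finite rank times a finite group: an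
automaton computes the finite part, and each integer coordinate is kept as two unary counters, for
its positive and negative contributions. One machine does all of this in linear time
(`inP_of_isRegular_of_counters`). -/

theorem evalsToInTime_head {σ : Type*} {f : σ → Option σ} {a b : σ} {c : Option σ} {m : ℕ}
    (h : f a = some b) (hb : Nonempty (EvalsToInTime f b c m)) :
    Nonempty (EvalsToInTime f a c (m + 1)) := by
  obtain ⟨⟨⟨k, hk⟩, hm⟩⟩ := hb
  refine ⟨⟨⟨k + 1, ?_⟩, Nat.succ_le_succ hm⟩⟩
  rw [Function.iterate_succ_apply]
  simpa [flip, h] using hk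

/-! A machine that runs a finite automaton and, at the same time, counts in unary on contents; after
the input has been read, the counters are compared in pairs. -/
namespace CounterMachine

/-- The contents: the input, the output, and two unary counters for each index. -/
inductive Stack (I : Type)
  | input
  | output
  | counter (j : I × Bool)
  deriving DecidableEq, Fintype

/-- The labels of the program. -/
inductive Label (S : Type)
  | scan
  | act (s : S)
  | compare
  | finish
  deriving Fintype

/-- The internal memory. -/
structure Memory (S Q : Type) where
  state : Q
  read : Option S
  nonempty : Bool
  more : Bool
  ok : Bool
  deriving Fintype

/-- The alphabets of the contents. -/
abbrev Alphabet (S I : Type) : Stack I → Type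
  | .input => S
  | .output => Bool
  | .counter _ => Unit

variable {S Q I : Type}

/-- The contents with given input, output and counter values. -/
def contents (w : List S) (o : List Bool) (c : I × Bool → ℕ) : ∀ k, List (Alphabet S I k)
  | .input => w
  | .output => o
  | .counter j => List.replicate (c j) ()

/-- Statements of the program. -/
abbrev Stmt (S Q I : Type) : Type := TM2.Stmt (Alphabet S I) (Label S) (Memory S Q)

/-- Add `amt j` to the counter `j`, for each `j` in a list. -/
def addAll (amt : I × Bool → ℕ) (l : List (I × Bool)) (q : Stmt S Q I) : Stmt S Q I :=
  l.foldr (fun j q => (TM2.Stmt.push (.counter j) fun _ => ())^[amt j] q) q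

/-- Decrease the two counters of each index in a list, and record whether one of them was positive
and whether they were positive at the same time. -/
def decreaseAll (l : List I) (q : Stmt S Q I) : Stmt S Q I :=
  l.foldr (fun i q =>
    .pop (.counter (i, true)) (fun v o => { v with nonempty := o.isSome }) <|
    .pop (.counter (i, false)) (fun v o =>
      { v with more := v.more || (v.nonempty || o.isSome), ok := v.ok && (v.nonempty == o.isSome) })
    q) q

/-- The initial content of the memory. -/
def initial (M : DFA S Q) : Memory S Q := ⟨M.start, none, false, false, true⟩

open Classical in
/-- The program. -/
noncomputable def program [Fintype I] (M : DFA S Q) (amt : S → I × Bool → ℕ) :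
    Label S → Stmt S Q I
  | .scan => .pop .input (fun v o => { v with read := o }) <|
      .goto fun v => v.read.elim .compare .act
  | .act s => .load (fun v => { v with state := M.step v.state s }) <|
      addAll (amt s) Finset.univ.toList <| .goto fun _ => .scan
  | .compare => .load (fun v => { v with more := false }) <|
      decreaseAll Finset.univ.toList <| .goto fun v => if v.more then .compare else .finish
  | .finish => .push .output (fun v => v.ok && decide (v.state ∈ M.accept)) <|
      .load (fun _ => initial M) .halt

/-- The machine. -/
noncomputable def machine [Fintype S] [Fintype Q] [Fintype I] [DecidableEq I] (M : DFA S Q)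
    (amt : S → I × Bool → ℕ) : FinTM2 where
  K := Stack I
  k₀ := .input
  k₁ := .output
  Γ := Alphabet S I
  Λ := Label S
  main := .scan
  σ := Memory S Q
  initialState := initial M
  Γk₀Fin := inferInstanceAs (Fintype S)
  m := program M amt

/-! ### Execution of the counter machine and its running time. -/

variable [DecidableEq I]

theorem update_input (w w' : List S) (o : List Bool) (c : I × Bool → ℕ) :
    Function.update (contents w o c) .input w' = contents w' o c := by
  funext k
  cases k <;> simp [contents]

theorem update_output (w : List S) (o o' : List Bool) (c : I × Bool → ℕ) :
    Function.update (contents w o c) .output o' = contents w o' c := by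
  funext k
  cases k <;> simp [contents]

theorem update_counter (w : List S) (o : List Bool) (c : I × Bool → ℕ) (j : I × Bool) (m : ℕ) :
    Function.update (contents w o c) (.counter j) (List.replicate m ()) =
      contents w o (Function.update c j m) := by
  funext k
  rcases k with _ | _ | i
  · simp [contents]
  · simp [contents]
  · by_cases h : i = j
    · subst h
      simp [contents]
    · simp [contents, h]

theorem stepAux_push_iterate (j : I × Bool) (m : ℕ) (q : Stmt S Q I) (v : Memory S Q) (w : List S)
    (o : List Bool) (c : I × Bool → ℕ) :
    TM2.stepAux ((TM2.Stmt.push (.counter j) fun _ => ())^[m] q) v (contents w o c) =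
      TM2.stepAux q v (contents w o (Function.update c j (c j + m))) := by
  induction m generalizing c with
  | zero => simp
  | succ m ih =>
    have h : (() :: contents w o c (.counter j) : List Unit) = List.replicate (c j + 1) () := rfl
    rw [Function.iterate_succ_apply', TM2.stepAux]
    erw [h, update_counter, ih]
    simp [add_left_comm, add_comm]

theorem stepAux_addAll (amt : I × Bool → ℕ) (l : List (I × Bool)) (q : Stmt S Q I)
    (v : Memory S Q) (w : List S) (o : List Bool) (c : I × Bool → ℕ) :
    TM2.stepAux (addAll amt l q) v (contents w o c) =
      TM2.stepAux q v (contents w o fun j => c j + l.count j * amt j) := by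
  induction l generalizing c with
  | nil => simp [addAll]
  | cons i l ih =>
    rw [addAll, List.foldr_cons, stepAux_push_iterate, ← addAll, ih]
    congr 2
    funext j
    by_cases h : j = i
    · subst h
      simp
      ring
    · simp [h, Ne.symm h]

/-- Popping an empty stack leaves it empty, which matches truncated subtraction. The list must have
no duplicates, so that each counter is tested at its original value. The leftover `b` in the scratch
bit is never used again. -/
theorem stepAux_decreaseAll (l : List I) (hl : l.Nodup) (q : Stmt S Q I)
    (v : Memory S Q) (w : List S) (o : List Bool) (c : I × Bool → ℕ) :
    ∃ b, TM2.stepAux (decreaseAll l q) v (contents w o c) =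
      TM2.stepAux q ⟨v.state, v.read, b,
        v.more || l.any fun i => decide (c (i, true) ≠ 0) || decide (c (i, false) ≠ 0),
        v.ok && l.all fun i => decide (c (i, true) ≠ 0) == decide (c (i, false) ≠ 0)⟩
        (contents w o fun j => if j.1 ∈ l then c j - 1 else c j) := by
  induction l generalizing c v with
  | nil => exact ⟨v.nonempty, by simp [decreaseAll]⟩
  | cons i l ih =>
    have hh (c : I × Bool → ℕ) (j : I × Bool) :
        (contents w o c (.counter j)).head?.isSome = decide (c j ≠ 0) := by
      rcases h : c j with _ | m <;> simp [contents, h, List.replicate_succ]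
    have ht (c : I × Bool → ℕ) (j : I × Bool) :
        (contents w o c (.counter j)).tail = List.replicate (c j - 1) () := by
      simp [contents]
    obtain ⟨hi, hl⟩ := List.nodup_cons.1 hl
    have hne (k : I) (hk : k ∈ l) : k ≠ i := fun h => hi (h ▸ hk)
    rw [decreaseAll, List.foldr_cons, ← decreaseAll, TM2.stepAux, TM2.stepAux, ht, update_counter,
      ht, update_counter]
    obtain ⟨b, hb⟩ := ih hl _ _
    refine ⟨b, hb.trans ?_⟩
    rw [hh, hh]
    congr 2
    · dsimp only
      rw [List.any_cons, Bool.or_assoc]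
      congr 2
      · simp
      · rw [Bool.eq_iff_iff, List.any_eq_true, List.any_eq_true]
        exact exists_congr fun k => and_congr_right fun hk => by simp [hne k hk]
    · dsimp only
      rw [List.all_cons, ← Bool.and_assoc]
      congr 1
      · simp
      · rw [Bool.eq_iff_iff, List.all_eq_true, List.all_eq_true]
        exact forall₂_congr fun k hk => by simp [hne k hk]
    · funext ⟨k, b⟩
      by_cases hk : k = i
      · subst hk
        cases b <;> simp [hi]
      · simp [hk]

variable [Fintype I]

/-- Evaluation of the machine within a given number of steps to a halting configuration. -/
def HaltsWithin (M : DFA S Q) (amt : S → I × Bool → ℕ)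
    (c : TM2.Cfg (Alphabet S I) (Label S) (Memory S Q)) (o : Bool) (m : ℕ) : Prop :=
  Nonempty (EvalsToInTime (TM2.step (program M amt)) c
    (some ⟨none, initial M, contents [] [o] 0⟩) m)

theorem HaltsWithin.head {M : DFA S Q} {amt : S → I × Bool → ℕ}
    {c c' : TM2.Cfg (Alphabet S I) (Label S) (Memory S Q)} {o : Bool} {m : ℕ}
    (h : TM2.step (program M amt) c = some c') (h' : HaltsWithin M amt c' o m) :
    HaltsWithin M amt c o (m + 1) :=
  evalsToInTime_head h h'

theorem HaltsWithin.mono {M : DFA S Q} {amt : S → I × Bool → ℕ}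
    {c : TM2.Cfg (Alphabet S I) (Label S) (Memory S Q)} {o : Bool} {m m' : ℕ}
    (h : HaltsWithin M amt c o m) (hm : m ≤ m') : HaltsWithin M amt c o m' :=
  h.map fun h => ⟨h.toEvalsTo, h.steps_le_m.trans hm⟩

open Classical in
theorem haltsWithin_finish (M : DFA S Q) (amt : S → I × Bool → ℕ) (v : Memory S Q) :
    HaltsWithin M amt ⟨some .finish, v, contents [] [] 0⟩
      (v.ok && decide (v.state ∈ M.accept)) 1 := by
  refine evalsToInTime_head (b := ⟨none, initial M, contents [] [_] 0⟩) ?_ ⟨.refl _ _⟩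
  rw [TM2.step, program, TM2.stepAux, TM2.stepAux, TM2.stepAux]
  erw [update_output]
  rfl

/-- The test looks at the counters before they are decreased, so the loop ends only after a round
that finds all of them zero. -/
theorem step_compare (M : DFA S Q) (amt : S → I × Bool → ℕ) (v : Memory S Q) (c : I × Bool → ℕ) :
    ∃ b, TM2.step (program M amt) ⟨some .compare, v, contents [] [] c⟩ =
      some ⟨some (if c = 0 then .finish else .compare),
        ⟨v.state, v.read, b, decide (c ≠ 0),
          v.ok && decide (∀ i, c (i, true) = 0 ↔ c (i, false) = 0)⟩,
        contents [] [] fun j => c j - 1⟩ := by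
  obtain ⟨b, hb⟩ := stepAux_decreaseAll (Finset.univ : Finset I).toList (Finset.nodup_toList _)
    (.goto fun v => if v.more then .compare else .finish) { v with more := false }
    ([] : List S) [] c
  refine ⟨b, ?_⟩
  have h0 : c = 0 ↔ ∀ i, c (i, true) = 0 ∧ c (i, false) = 0 := by
    simp [funext_iff, Prod.forall, Bool.forall_bool, and_comm]
  have hmore : ((Finset.univ : Finset I).toList.any fun i =>
      decide (c (i, true) ≠ 0) || decide (c (i, false) ≠ 0)) = decide (c ≠ 0) := by
    rw [Bool.eq_iff_iff, List.any_eq_true, decide_eq_true_iff, Ne, h0]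
    simp [imp_iff_not_or]
  have hok : ((Finset.univ : Finset I).toList.all fun i =>
      decide (c (i, true) ≠ 0) == decide (c (i, false) ≠ 0)) =
      decide (∀ i, c (i, true) = 0 ↔ c (i, false) = 0) := by
    rw [Bool.eq_iff_iff, List.all_eq_true, decide_eq_true_iff]
    simp
  rw [TM2.step, program, TM2.stepAux, hb, TM2.stepAux]
  simp only [Finset.mem_toList, Finset.mem_univ, if_true, hmore, hok, Bool.false_or]
  by_cases h : c = 0 <;> simp [h]

-- At most `N` rounds empty the counters, one more finds them empty, and one step writes the output:
-- hence `N + 2`.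
open Classical in
theorem haltsWithin_compare (M : DFA S Q) (amt : S → I × Bool → ℕ) (N : ℕ) (v : Memory S Q)
    (c : I × Bool → ℕ) (hc : ∀ j, c j ≤ N) :
    HaltsWithin M amt ⟨some .compare, v, contents [] [] c⟩
      ((v.ok && decide (∀ i, c (i, true) = c (i, false))) && decide (v.state ∈ M.accept))
      (N + 2) := by
  induction N generalizing v c with
  | zero =>
    obtain rfl : c = 0 := funext fun j => by simpa using hc j
    obtain ⟨b, hb⟩ := step_compare M amt v 0
    refine .head hb ?_
    convert haltsWithin_finish M amt _ using 3 <;> simp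
    rfl
  | succ N ih =>
    obtain ⟨b, hb⟩ := step_compare M amt v c
    refine .head hb ?_
    split_ifs with h
    · subst h
      refine HaltsWithin.mono ?_ (Nat.le_add_left 1 _)
      convert haltsWithin_finish M amt _ using 3 <;> simp
      rfl
    · convert ih _ (fun j => c j - 1) (fun j => by have := hc j; omega) using 1
      rw [Bool.eq_iff_iff]
      -- Two naturals are equal exactly when they vanish together and their truncated predecessors
      -- agree; this is what one round checks.
      have key : (∀ i, c (i, true) = c (i, false)) ↔
          (∀ i, c (i, true) = 0 ↔ c (i, false) = 0) ∧
            ∀ i, c (i, true) - 1 = c (i, false) - 1 := by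
        rw [← forall_and]
        exact forall_congr' fun i => by omega
      simp [key, and_assoc]

-- Each letter costs two steps (`scan`, `act`), the end of the input one, and the comparison `N +
-- 2`. The bound `hc` includes what the unread input will still add, so it is preserved along the
-- run.
open Classical in
theorem haltsWithin_scan (M : DFA S Q) (amt : S → I × Bool → ℕ) (N : ℕ) (w : List S)
    (v : Memory S Q) (c : I × Bool → ℕ) (hc : ∀ j, c j + (w.map fun s => amt s j).sum ≤ N) :
    HaltsWithin M amt ⟨some .scan, v, contents w [] c⟩
      ((v.ok && decide (∀ i, c (i, true) + (w.map fun s => amt s (i, true)).sum =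
          c (i, false) + (w.map fun s => amt s (i, false)).sum)) &&
        decide (M.evalFrom v.state w ∈ M.accept))
      (2 * w.length + N + 3) := by
  induction w generalizing v c with
  | nil =>
    refine .head (c' := ⟨some .compare, { v with read := none }, contents [] [] c⟩) ?_ ?_
    · rw [TM2.step, program, TM2.stepAux]
      erw [update_input]
      rfl
    · convert haltsWithin_compare M amt N _ c (by simpa using hc) using 1
      · rw [Bool.eq_iff_iff]
        simp
        exact fun _ _ => decide_eq_true_iff
      · simp
  | cons s w ih =>
    have hact : TM2.step (program M amt) ⟨some (.act s), { v with read := some s },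
        contents w [] c⟩ = some ⟨some .scan, { v with read := some s, state := M.step v.state s },
          contents w [] fun j => c j + amt s j⟩ := by
      rw [TM2.step, program, TM2.stepAux, stepAux_addAll]
      simp [List.count_eq_one_of_mem (Finset.nodup_toList _)]
    refine .head (c' := ⟨some (.act s), { v with read := some s }, contents w [] c⟩) ?_
      (.head hact ?_)
    · rw [TM2.step, program, TM2.stepAux]
      erw [update_input]
      rfl
    · convert ih { v with read := some s, state := M.step v.state s }
        (fun j => c j + amt s j) (fun j => by simpa [add_assoc] using hc j) using 1
      · rw [Bool.eq_iff_iff]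
        simp [add_assoc]
        exact fun _ _ => decide_eq_true_iff
      · rw [List.length_cons]
        ring

variable [Fintype S] [Fintype Q]

/-- Halting output requires the initial memory and empty stacks apart from the output; hence the
reset in `finish` and the emptying of all counters in `compare`. -/
theorem haltList_machine (M : DFA S Q) (amt : S → I × Bool → ℕ) (o : List Bool) :
    haltList (machine M amt) o = ⟨none, initial M, contents [] o 0⟩ := by
  refine congrArg (TM2.Cfg.mk none (initial M)) ?_
  funext k
  cases k <;> rfl

theorem initList_machine (M : DFA S Q) (amt : S → I × Bool → ℕ) (w : List S) :
    initList (machine M amt) w = ⟨some .scan, initial M, contents w [] 0⟩ := by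
  refine congrArg (TM2.Cfg.mk (some Label.scan) (initial M)) ?_
  funext k
  cases k <;> rfl

theorem HaltsWithin.outputsInTime {M : DFA S Q} {amt : S → I × Bool → ℕ} {w : List S} {o : Bool}
    {m : ℕ} (h : HaltsWithin M amt ⟨some .scan, initial M, contents w [] 0⟩ o m) :
    Nonempty (TM2OutputsInTime (machine M amt) w (some [o]) m) := by
  unfold HaltsWithin at h
  erw [← haltList_machine M amt [o], ← initList_machine M amt w] at h
  exact h

end CounterMachine

/-! ### Regular conditions and vanishing sums in polynomial time. -/

open CounterMachine in
/-- Membership in a regular language together with the equality of finitely many pairs of sums of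
letter weights can be decided in polynomial time. -/
theorem inP_of_isRegular_of_counters {S I : Type} [Fintype S] [Fintype I] (L : Language S)
    (hL : L.IsRegular) (amt : S → I × Bool → ℕ) :
    InP {w | w ∈ L ∧ ∀ i, (w.map fun s => amt s (i, true)).sum =
      (w.map fun s => amt s (i, false)).sum} := by
  classical
  obtain ⟨Q, _, M, rfl⟩ := hL
  -- A crude bound for the growth of any counter per letter; it depends only on the fixed alphabet
  -- and weights.
  let N : ℕ := ∑ s, ∑ j, amt s j
  have hN (w : List S) (j : I × Bool) : (w.map fun s => amt s j).sum ≤ N * w.length := by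
    rw [mul_comm, ← smul_eq_mul]
    refine (List.sum_le_card_nsmul _ N ?_).trans_eq (by simp)
    simp only [List.mem_map, forall_exists_index, and_imp, forall_apply_eq_imp_iff₂]
    exact fun s _ => (Finset.single_le_sum (f := fun j => amt s j) (by simp)
      (Finset.mem_univ j)).trans (Finset.single_le_sum (f := fun s => ∑ j, amt s j) (by simp)
      (Finset.mem_univ s))
  refine ⟨{
    tm := machine M amt
    inputAlphabet := Equiv.refl S
    outputAlphabet := Equiv.refl Bool
    time := (2 + Polynomial.C N) * Polynomial.X + 3
    outputsFun := fun w => Classical.choice ?_ }⟩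
  have key (w' : List S) (b b' : Bool) (o : List Bool) (t t' : ℕ) (hw : w' = w) (ho : o = [b'])
      (hb : b' = b) (ht : t' = t)
      (h : HaltsWithin M amt ⟨some .scan, initial M, contents w [] 0⟩ b t) :
      Nonempty (TM2OutputsInTime (machine M amt) w' (some o) t') := by
    subst hw ho hb ht
    exact h.outputsInTime
  refine key _ _ _ _ _ _ (List.map_id w) (List.map_id _) ?_ ?_
    (haltsWithin_scan M amt (N * w.length) w (initial M) 0 (by simpa using hN w))
  · rw [Bool.eq_iff_iff]
    simp [DFA.mem_accepts, DFA.eval, initial, and_comm]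
    exact fun _ => decide_eq_true_iff.symm
  · simp
    ring

/-- Counting a letter up to a bound is regular. -/
theorem Language.isRegular_le_countP {S : Type} (p : S → Bool) (G : ℕ) :
    Language.IsRegular ({w | G ≤ w.countP p} : Language S) := by
  -- A counter that saturates at `G`.
  let M : DFA S (Fin (G + 1)) :=
    { step := fun i s => if p s then ⟨min (i + 1) G, by omega⟩ else i
      start := 0
      accept := {i | G ≤ i} }
  have h (w : List S) (i : Fin (G + 1)) :
      (M.evalFrom i w : ℕ) = min (i + w.countP p) G := by
    induction w generalizing i with
    | nil => simp [Nat.le_of_lt_succ i.2]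
    | cons s w ih =>
      rw [DFA.evalFrom_cons, ih, List.countP_cons]
      by_cases hs : p s
      · simp only [M, hs, if_true]
        omega
      · simp [M, hs]
  refine ⟨Fin (G + 1), inferInstance, M, ?_⟩
  ext w
  change G ≤ (M.evalFrom 0 w : ℕ) ↔ _
  rw [h]
  simp only [Fin.val_zero, zero_add, le_min_iff, le_refl, and_true]
  rfl

/-- The words whose letters have sum zero in a finite monoid form a regular language. -/
theorem Language.isRegular_sum_eq_zero {S F : Type} [AddMonoid F] [Fintype F] (h : S → F) :
    Language.IsRegular ({w | (w.map h).sum = 0} : Language S) := by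
  let M : DFA S F :=
    { step := fun x s => x + h s
      start := 0
      accept := {0} }
  have hM (w : List S) (x : F) : M.evalFrom x w = x + (w.map h).sum := by
    induction w generalizing x with
    | nil => simp
    | cons s w ih => rw [DFA.evalFrom_cons, ih, List.map_cons, List.sum_cons, ← add_assoc]
  refine ⟨F, inferInstance, M, ?_⟩
  ext w
  change M.evalFrom 0 w = 0 ↔ _
  rw [hM, zero_add]
  rfl

/-- Membership in a regular language together with a sum of letter weights being zero in a finitely
generated abelian group can be decided in polynomial time. -/
theorem inP_of_isRegular_of_sum_eq_zero {S : Type} [Fintype S] {C : Type*} [AddCommGroup C]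
    [AddGroup.FG C] (L : Language S) (hL : L.IsRegular) (h : S → C) :
    InP {w | w ∈ L ∧ (w.map h).sum = 0} := by
  classical
  obtain ⟨r, ι, _, p, hp, e, ⟨φ⟩⟩ := AddCommGroup.equiv_free_prod_directSum_zmod C
  have (i : ι) : NeZero (p i ^ e i) := ⟨pow_ne_zero _ (hp i).ne_zero⟩
  have : Fintype (DirectSum ι fun i => ZMod (p i ^ e i)) :=
    Fintype.ofEquiv _ (DirectSum.addEquivProd _).symm.toEquiv
  -- Positive and negative parts of the integer coordinates; `toNat` is zero on the wrong sign.
  let amt (s : S) (j : Fin r × Bool) : ℕ :=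
    if j.2 then ((φ (h s)).1 j.1).toNat else (-(φ (h s)).1 j.1).toNat
  convert inP_of_isRegular_of_counters (L ⊓ {w | (w.map fun s => (φ (h s)).2).sum = 0})
    (hL.inf (Language.isRegular_sum_eq_zero _)) amt using 1
  ext w
  have h1 : (φ (w.map h).sum).2 = (w.map fun s => (φ (h s)).2).sum := by
    change ((AddMonoidHom.snd _ _).comp φ.toAddMonoidHom) _ = _
    rw [map_list_sum, List.map_map]
    rfl
  have h2 (i : Fin r) : (φ (w.map h).sum).1 i =
      ((w.map fun s => amt s (i, true)).sum : ℤ) - ((w.map fun s => amt s (i, false)).sum : ℕ) := by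
    change ((Finsupp.applyAddHom i).comp ((AddMonoidHom.fst _ _).comp φ.toAddMonoidHom)) _ = _
    rw [map_list_sum, List.map_map]
    clear h1
    induction w with
    | nil => simp
    | cons s w ih =>
      have hs : (φ (h s)).1 i = (amt s (i, true) : ℤ) - amt s (i, false) := by
        simp only [amt, if_true, Bool.false_eq_true, if_false]
        omega
      simp only [List.map_cons, List.sum_cons, Function.comp_apply] at ih ⊢
      rw [ih]
      change (φ (h s)).1 i + _ = _
      rw [hs]
      push_cast
      ring
  change w ∈ L ∧ _ ↔ (w ∈ L ∧ _ = _) ∧ _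
  rw [and_assoc, ← φ.map_eq_zero_iff, Prod.ext_iff, Finsupp.ext_iff, h1]
  simp only [h2, Prod.fst_zero, Finsupp.coe_zero, Pi.zero_apply, Prod.snd_zero, sub_eq_zero,
    Nat.cast_inj]
  rw [and_comm (a := ∀ _, _)]

/-! ### Strings that represent equations. -/

namespace EqSymbol

variable {n k : ℕ}

instance : Finite (EqSymbol n k) :=
  Finite.of_surjective (α := (Bool ⊕ Bool ⊕ Bool) ⊕ WreathLetter n k)
    (Sum.elim (Sum.elim .x (Sum.elim .y .z)) .letter) <| by
      rintro (s | s | s | l)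
      exacts [⟨.inl (.inl s), rfl⟩, ⟨.inl (.inr (.inl s)), rfl⟩, ⟨.inl (.inr (.inr s)), rfl⟩,
        ⟨.inr l, rfl⟩]

/-- The symbols `x` and `x⁻¹`, which each occur once per handle. -/
def isX : EqSymbol n k → Bool
  | .x _ => true
  | _ => false

end EqSymbol

/-- The states of an automaton that recognizes the strings that represent equations. -/
inductive EncodeState
  | start
  | invX
  | invY
  | posX
  | between
  | inside
  | dead

instance : Finite EncodeState :=
  Finite.of_surjective (α := Fin 7) ![.start, .invX, .invY, .posX, .between, .inside, .dead] <| by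
    rintro (_ | _ | _ | _ | _ | _ | _)
    exacts [⟨0, rfl⟩, ⟨1, rfl⟩, ⟨2, rfl⟩, ⟨3, rfl⟩, ⟨4, rfl⟩, ⟨5, rfl⟩, ⟨6, rfl⟩]

namespace OrientableInput

variable {n k : ℕ}

/-- The string `z⁻¹ c₁ z ⋯ z⁻¹ cₘ z`. -/
def encodeConst (cs : List (List (WreathLetter n k))) : List (EqSymbol n k) :=
  (cs.map fun c => EqSymbol.z false :: (c.map EqSymbol.letter ++ [EqSymbol.z true])).flatten

/-- The string of an equation given by its genus and the list of its constants. -/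
def encodeList (g : ℕ) (cs : List (List (WreathLetter n k))) : List (EqSymbol n k) :=
  (List.replicate g
      [EqSymbol.x false, EqSymbol.y false, EqSymbol.x true, EqSymbol.y true]).flatten ++
    encodeConst cs

theorem encode_eq (E : OrientableInput n k) :
    E.encode = encodeList E.genus (List.ofFn E.const) := by
  rw [encode, encodeList, encodeConst, List.map_ofFn]
  rfl

/-- An automaton that recognizes the strings that represent equations. -/
def encodeDFA (n k : ℕ) : DFA (EqSymbol n k) EncodeState where
  step
    | .start, .x false => .invX
    | .invX, .y false => .invY
    | .invY, .x true => .posX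
    | .posX, .y true => .start
    | .start, .z false => .inside
    | .between, .z false => .inside
    | .inside, .letter _ => .inside
    | .inside, .z true => .between
    | _, _ => .dead
  start := .start
  accept := {.start, .between}

/-- The strings that the automaton accepts from a given state. -/
def acceptsFrom : EncodeState → List (EqSymbol n k) → Prop
  | .start, w => ∃ g cs, w = encodeList g cs
  | .invX, w => ∃ g cs, w = .y false :: .x true :: .y true :: encodeList g cs
  | .invY, w => ∃ g cs, w = .x true :: .y true :: encodeList g cs
  | .posX, w => ∃ g cs, w = .y true :: encodeList g cs
  | .between, w => ∃ cs, w = encodeConst cs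
  | .inside, w => ∃ (c : List (WreathLetter n k)) (cs : _),
      w = c.map .letter ++ .z true :: encodeConst cs
  | .dead, _ => False

@[simp] theorem encodeConst_nil : encodeConst ([] : List (List (WreathLetter n k))) = [] := rfl

@[simp] theorem encodeConst_cons (c : List (WreathLetter n k)) (cs) :
    encodeConst (c :: cs) = .z false :: (c.map .letter ++ .z true :: encodeConst cs) := by
  simp [encodeConst]

@[simp] theorem encodeList_zero (cs : List (List (WreathLetter n k))) :
    encodeList 0 cs = encodeConst cs := rfl

@[simp] theorem encodeList_succ (g : ℕ) (cs : List (List (WreathLetter n k))) :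
    encodeList (g + 1) cs =
      .x false :: .y false :: .x true :: .y true :: encodeList g cs := by
  simp [encodeList, List.replicate_succ]

theorem exists_cons_eq_encodeConst (s : EqSymbol n k) (w : List (EqSymbol n k)) :
    (∃ cs, s :: w = encodeConst cs) ↔ s = .z false ∧ acceptsFrom .inside w := by
  constructor
  · rintro ⟨_ | ⟨c, cs⟩, h⟩
    · simp at h
    · rw [encodeConst_cons, List.cons.injEq] at h
      exact ⟨h.1, c, cs, h.2⟩
  · rintro ⟨rfl, c, cs, rfl⟩
    exact ⟨c :: cs, by simp⟩

theorem exists_cons_eq_encodeList (s : EqSymbol n k) (w : List (EqSymbol n k)) :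
    (∃ g cs, s :: w = encodeList g cs) ↔
      (s = .x false ∧ acceptsFrom .invX w) ∨ (s = .z false ∧ acceptsFrom .inside w) := by
  rw [← exists_cons_eq_encodeConst]
  constructor
  · rintro ⟨_ | g, cs, h⟩
    · exact .inr ⟨cs, h⟩
    · rw [encodeList_succ, List.cons.injEq] at h
      exact .inl ⟨h.1, g, cs, h.2⟩
  · rintro (⟨rfl, g, cs, rfl⟩ | ⟨cs, h⟩)
    · exact ⟨g + 1, cs, by simp⟩
    · exact ⟨0, cs, h⟩

theorem exists_cons_eq_map_letter_append (s : EqSymbol n k) (w : List (EqSymbol n k)) :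
    (∃ (c : List (WreathLetter n k)) (cs : _), s :: w = c.map .letter ++ .z true :: encodeConst cs) ↔
      (s = .z true ∧ acceptsFrom .between w) ∨ ∃ l, s = .letter l ∧ acceptsFrom .inside w := by
  constructor
  · rintro ⟨_ | ⟨l, c⟩, cs, h⟩
    · rw [List.map_nil, List.nil_append, List.cons.injEq] at h
      exact .inl ⟨h.1, cs, h.2⟩
    · rw [List.map_cons, List.cons_append, List.cons.injEq] at h
      exact .inr ⟨l, h.1, c, cs, h.2⟩
  · rintro (⟨rfl, cs, rfl⟩ | ⟨l, rfl, c, cs, rfl⟩)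
    · exact ⟨[], cs, rfl⟩
    · exact ⟨l :: c, cs, rfl⟩

theorem acceptsFrom_dead (w : List (EqSymbol n k)) : ¬ acceptsFrom .dead w := id

theorem acceptsFrom_nil (q : EncodeState) :
    acceptsFrom q ([] : List (EqSymbol n k)) ↔ q ∈ (encodeDFA n k).accept := by
  cases q
  case start => exact iff_of_true ⟨0, [], rfl⟩ (by simp [encodeDFA])
  case between => exact iff_of_true ⟨[], rfl⟩ (by simp [encodeDFA])
  all_goals simp [acceptsFrom, encodeDFA]

/-- With `acceptsFrom_nil`, this shows that the languages `acceptsFrom q` satisfy the recursion that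
defines acceptance from `q`, so they are the residual languages of the automaton. -/
theorem acceptsFrom_cons (q : EncodeState) (s : EqSymbol n k) (w : List (EqSymbol n k)) :
    acceptsFrom q (s :: w) ↔ acceptsFrom ((encodeDFA n k).step q s) w := by
  cases q
  case start =>
    refine (exists_cons_eq_encodeList s w).trans ?_
    rcases s with (_ | _) | (_ | _) | (_ | _) | _ <;>
      simp [encodeDFA, acceptsFrom_dead]
  case between =>
    refine (exists_cons_eq_encodeConst s w).trans ?_
    rcases s with (_ | _) | (_ | _) | (_ | _) | _ <;>
      simp [encodeDFA, acceptsFrom_dead]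
  case inside =>
    refine (exists_cons_eq_map_letter_append s w).trans ?_
    rcases s with (_ | _) | (_ | _) | (_ | _) | _ <;>
      simp [encodeDFA, acceptsFrom_dead]
  all_goals rcases s with (_ | _) | (_ | _) | (_ | _) | _ <;> simp [acceptsFrom, encodeDFA]

theorem evalFrom_encodeDFA_mem_accept (q : EncodeState) (w : List (EqSymbol n k)) :
    (encodeDFA n k).evalFrom q w ∈ (encodeDFA n k).accept ↔ acceptsFrom q w := by
  induction w generalizing q with
  | nil => exact (acceptsFrom_nil q).symm
  | cons s w ih => rw [DFA.evalFrom_cons, ih, acceptsFrom_cons]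

/-- The strings that represent equations form a regular language. -/
theorem isRegular_range_encode :
    Language.IsRegular (Set.range (encode (n := n) (k := k)) : Language (EqSymbol n k)) := by
  refine ⟨EncodeState, Fintype.ofFinite _, encodeDFA n k, ?_⟩
  ext w
  refine (evalFrom_encodeDFA_mem_accept .start w).trans ?_
  constructor
  · rintro ⟨g, cs, rfl⟩
    exact ⟨⟨g, cs.length, cs.get⟩, by simp [encode_eq]⟩
  · rintro ⟨E, rfl⟩
    exact ⟨_, _, encode_eq E⟩

/-- Turns the genus condition, in the form `rank ≤ 2 g`, into a bounded count of symbols. -/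
theorem countP_isX_encode (E : OrientableInput n k) :
    E.encode.countP EqSymbol.isX = 2 * E.genus := by
  have hl (c : List (WreathLetter n k)) :
      (c.map EqSymbol.letter).countP (EqSymbol.isX (n := n) (k := k)) = 0 := by
    rw [List.countP_map, List.countP_eq_zero]
    simp [EqSymbol.isX]
  have hc (cs : List (List (WreathLetter n k))) :
      (encodeConst cs).countP EqSymbol.isX = 0 := by
    induction cs with
    | nil => rfl
    | cons c cs ih => simp [-List.countP_map, EqSymbol.isX, ih, hl]
  rw [encode_eq]
  induction E.genus with
  | zero => exact hc _
  | succ g ih =>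
    rw [encodeList_succ]
    simp [EqSymbol.isX, ih, List.countP_cons]
    ring

/-- Additive invariants of the constants can be summed along the raw string, without parsing it. -/
theorem sum_map_encode {C : Type*} [AddCommMonoid C] (h : EqSymbol n k → C)
    (hx : ∀ b, h (.x b) = 0) (hy : ∀ b, h (.y b) = 0) (hz : ∀ b, h (.z b) = 0)
    (E : OrientableInput n k) :
    (E.encode.map h).sum = ∑ j, ((E.const j).map fun l => h (.letter l)).sum := by
  have hc (cs : List (List (WreathLetter n k))) :
      ((encodeConst cs).map h).sum = (cs.map fun c => (c.map fun l => h (.letter l)).sum).sum := by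
    induction cs with
    | nil => rfl
    | cons c cs ih =>
      rw [encodeConst_cons]
      simp [ih, hz, Function.comp_def]
  rw [encode_eq, ← List.sum_ofFn, ← Function.comp_def (fun c => (List.map _ c).sum) E.const,
    ← List.map_ofFn, ← hc]
  induction E.genus with
  | zero => rfl
  | succ g ih =>
    rw [encodeList_succ]
    simp [ih, hx, hy]

end OrientableInput

/-! ### Abelianization, commutators and shift differences. -/

namespace RestrictedWreath

variable {A : Type u} {B : Type v} [AddCommGroup A] [AddCommGroup B]

/-- The shift as an endomorphism of the group of lamp configurations. -/
noncomputable def shiftHom (b : B) : (B →₀ A) →+ (B →₀ A) where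
  toFun f := shift f b
  map_zero' := by ext; simp
  map_add' f g := by ext; simp

@[simp] theorem shiftHom_apply (b : B) (f : B →₀ A) : shiftHom b f = shift f b := rfl

theorem shift_add (f : B →₀ A) (b c : B) : shift f (b + c) = shift (shift f b) c := by
  ext x
  simp [add_assoc]

@[simp] theorem shift_zero (f : B →₀ A) : shift f 0 = f := by
  ext x
  simp

theorem shift_single_self (b : B) (a : A) :
    shift (Finsupp.single b a) b = Finsupp.single 0 a := by
  classical
  ext x
  simp [Finsupp.single_apply, eq_comm]

theorem sum_shift (f : B →₀ A) (b : B) : ((shift f b).sum fun _ a => a) = f.sum fun _ a => a := by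
  refine Finsupp.sum_comapDomain (fun x => b + x) f (fun _ a => a) ⟨fun x hx => hx,
    fun x _ y _ h => add_left_cancel h, fun y hy => ⟨-b + y, by simpa using hy, by simp⟩⟩

@[simp] theorem lampSum_one : (1 : RestrictedWreath A B).lampSum = 0 := by
  simp [lampSum]

theorem lampSum_mul (p q : RestrictedWreath A B) : (p * q).lampSum = p.lampSum + q.lampSum := by
  rw [lampSum, mul_lamp, Finsupp.sum_add_index' (by simp) (by simp), sum_shift]
  rfl

/-- The `B`-component and the sum of the lamps form a homomorphism to an abelian group. -/
noncomputable def abelianized : RestrictedWreath A B →* Multiplicative (B × A) where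
  toFun p := .ofAdd (p.base, p.lampSum)
  map_one' := by simp
  map_mul' p q := by rw [lampSum_mul]; rfl

/-- The lamp configurations form a subgroup. -/
noncomputable def lampHom : Multiplicative (B →₀ A) →* RestrictedWreath A B where
  toFun f := ⟨0, f.toAdd⟩
  map_one' := rfl
  map_mul' f h := by ext <;> simp

theorem abelianized_eq_one_iff (p : RestrictedWreath A B) :
    abelianized p = 1 ↔ p.base = 0 ∧ p.lampSum = 0 := Prod.ext_iff

/-- The commutator `x⁻¹ y⁻¹ x y` has trivial `B`-component. -/
theorem commutator_eq (b c : B) (f h : B →₀ A) :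
    (⟨b, f⟩ : RestrictedWreath A B)⁻¹ * ⟨c, h⟩⁻¹ * ⟨b, f⟩ * ⟨c, h⟩ =
      ⟨0, (shift f c - f) - (shift h b - h)⟩ := by
  ext x
  · simp
  · simp only [mul_lamp, inv_lamp, inv_base, Finsupp.add_apply, Finsupp.neg_apply,
      Finsupp.sub_apply, shift_apply]
    have h1 : -b + (-c + (b + (c + x))) = x := by abel
    have h2 : -c + (b + (c + x)) = b + x := by abel
    rw [h1, h2]
    abel

/-- A configuration of total lamp sum zero is a sum of differences `f ^ b - f` over any generating
family of `B`. -/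
theorem exists_sum_shift_sub_eq {ι : Type*} [Fintype ι] (b : ι → B)
    (hb : AddSubgroup.closure (Set.range b) = ⊤) (f : B →₀ A) (hf : (f.sum fun _ a => a) = 0) :
    ∃ h : ι → B →₀ A, ∑ i, (shift (h i) (b i) - h i) = f := by
  classical
  let D : (ι → B →₀ A) →+ (B →₀ A) :=
    ∑ i, (shiftHom (b i) - AddMonoidHom.id _).comp (Pi.evalAddMonoidHom _ i)
  have hD (h : ι → B →₀ A) : D h = ∑ i, (shift (h i) (b i) - h i) := by
    simp [D]
  -- The elements `c` that satisfy this for all `f` form a subgroup, so generators suffice. The sum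
  -- case telescopes through `shift f c`, which is why `f` is generalized.
  have hmem (c : B) (f : B →₀ A) : shift f c - f ∈ D.range := by
    have hc : c ∈ AddSubgroup.closure (Set.range b) := hb ▸ AddSubgroup.mem_top c
    induction hc using AddSubgroup.closure_induction generalizing f with
    | mem c hc =>
      obtain ⟨i, rfl⟩ := hc
      refine ⟨Pi.single i f, ?_⟩
      rw [hD, Finset.sum_eq_single i]
      · simp
      · intro j _ hj
        ext
        simp [hj]
      · simp
    | zero => simp
    | add c d _ _ hc hd =>
      have := add_mem (hd (shift f c)) (hc f)
      rwa [← shift_add, sub_add_sub_cancel] at this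
    | neg c _ hc =>
      have := neg_mem (hc (shift f (-c)))
      rwa [← shift_add, neg_add_cancel, shift_zero, neg_sub] at this
  have hf' : f ∈ D.range := by
    -- Moving every lamp to `0` gives the zero configuration, because the lamp sum vanishes;
    -- subtracting it costs nothing and leaves differences of a lamp and its translate.
    have h1 : f = f.sum fun x a => Finsupp.single x a - Finsupp.single 0 a := by
      have h2 : (f.sum fun _ a => Finsupp.single (0 : B) a) = 0 := by
        have := congrArg (Finsupp.singleAddHom (0 : B)) hf
        rw [map_zero, Finsupp.sum, map_sum] at this
        exact this
      rw [Finsupp.sum_sub, h2, sub_zero, Finsupp.sum_single]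
    rw [h1]
    refine sum_mem fun x _ => ?_
    have := neg_mem (hmem x (Finsupp.single x (f x)))
    rwa [shift_single_self, neg_sub] at this
  obtain ⟨h, hh⟩ := hf'
  exact ⟨h, by rw [← hh, hD]⟩

end RestrictedWreath

/-! ### Solvability criterion and decision procedure. -/

/-- A solution of an orientable equation is a choice of values of its variables. -/
theorem hasSolution_orientableWord_iff {G : Type*} [Group G] (g : ℕ) {m : ℕ} (c : Fin m → G) :
    HasSolution (orientableWord g c) ↔ ∃ (x y : Fin g → G) (z : Fin m → G),
      (List.ofFn fun i => (x i)⁻¹ * (y i)⁻¹ * x i * y i).prod *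
        (List.ofFn fun j => (z j)⁻¹ * c j * z j).prod = 1 := by
  constructor
  · rintro ⟨φ, hφ, h⟩
    refine ⟨fun i => φ (varElem G (.x i)), fun i => φ (varElem G (.y i)),
      fun j => φ (varElem G (.z j)), ?_⟩
    have hc (a : G) : φ (Monoid.Coprod.inr a) = a := DFunLike.congr_fun hφ a
    simpa [orientableWord, map_list_prod, List.map_ofFn, Function.comp_def, hc] using h
  · rintro ⟨x, y, z, h⟩
    -- Variables that do not occur in the word get the value `1`.
    let v : EqVar → G
      | .x i => if hi : i < g then x ⟨i, hi⟩ else 1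
      | .y i => if hi : i < g then y ⟨i, hi⟩ else 1
      | .z j => if hj : j < m then z ⟨j, hj⟩ else 1
    refine ⟨Monoid.Coprod.lift (FreeGroup.lift v) (MonoidHom.id G), by simp, ?_⟩
    simpa [orientableWord, map_list_prod, List.map_ofFn, Function.comp_def, varElem, v] using h

namespace RestrictedWreath

variable {A : Type u} {B : Type v} [AddCommGroup A] [AddCommGroup B]

/-- A group of rank at most `n` is generated by a family of `n` elements. -/
theorem exists_generators [AddGroup.FG B] {n : ℕ} (h : AddGroup.rank B ≤ n) :
    ∃ b : Fin n → B, AddSubgroup.closure (Set.range b) = ⊤ := by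
  obtain ⟨s, hs, hs'⟩ := AddGroup.rank_spec B
  let e : s ≃ Fin (AddGroup.rank B) := hs ▸ s.equivFin
  -- A minimal generating set, padded with zeros.
  refine ⟨fun i => if hi : (i : ℕ) < AddGroup.rank B then (e.symm ⟨i, hi⟩ : B) else 0, ?_⟩
  rw [eq_top_iff, ← hs', AddSubgroup.closure_le]
  intro x hx
  refine AddSubgroup.subset_closure ⟨Fin.castLE h (e ⟨x, hx⟩), ?_⟩
  simp

/-- Orientable equations of high genus are solvable exactly when they are solvable in the quotient
`B × A`. -/
theorem hasSolution_iff [AddGroup.FG B] (g m : ℕ) (c : Fin m → RestrictedWreath A B)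
    (hg : (AddGroup.rank B : ℝ) / 2 ≤ g) :
    HasSolution (orientableWord g c) ↔
        ∑ j, (c j).base = 0 ∧ ∑ j, (c j).lampSum = 0 := by
  rw [hasSolution_orientableWord_iff]
  have hsum (z : Fin m → RestrictedWreath A B) :
      abelianized (List.ofFn fun j => (z j)⁻¹ * c j * z j).prod =
        .ofAdd (∑ j, (c j).base, ∑ j, (c j).lampSum) := by
    rw [map_list_prod, List.map_ofFn, List.prod_ofFn]
    have (j : Fin m) : abelianized ((z j)⁻¹ * c j * z j) = .ofAdd ((c j).base, (c j).lampSum) := by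
      rw [map_mul, map_mul, map_inv, mul_right_comm, inv_mul_cancel, one_mul]
      rfl
    simp only [Function.comp_apply, this]
    rw [← ofAdd_sum]
    exact congrArg Multiplicative.ofAdd (Prod.ext Prod.fst_sum Prod.snd_sum)
  constructor
  · rintro ⟨x, y, z, h⟩
    have h' := congrArg abelianized h
    have hxy : abelianized (List.ofFn fun i => (x i)⁻¹ * (y i)⁻¹ * x i * y i).prod = 1 := by
      rw [map_list_prod, List.map_ofFn, List.prod_ofFn]
      refine Finset.prod_eq_one fun i _ => ?_
      simp only [Function.comp_apply, map_mul, map_inv]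
      rw [mul_comm (_⁻¹), mul_assoc, mul_assoc, inv_mul_cancel_left, inv_mul_cancel]
    rw [map_mul, hxy, one_mul, hsum, map_one] at h'
    exact Prod.ext_iff.1 h'
  · rintro ⟨h1, h2⟩
    have hrank : AddGroup.rank B ≤ g * 2 := by
      rw [div_le_iff₀ two_pos] at hg
      exact_mod_cast hg
    obtain ⟨b, hb⟩ := exists_generators hrank
    set P : RestrictedWreath A B := (List.ofFn c).prod with hP
    have hP' : abelianized P = 1 := by
      have := hsum 1
      simp only [Pi.one_apply, inv_one, one_mul, mul_one, h1, h2] at this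
      exact this
    obtain ⟨hP0, hP1⟩ := (abelianized_eq_one_iff P).1 hP'
    -- Two generators are assigned to each handle.
    let b' (i : Fin g × Fin 2) : B := b (finProdFinEquiv i)
    have hb' : AddSubgroup.closure (Set.range b') = ⊤ := by
      rw [← hb, ← finProdFinEquiv.surjective.range_comp]
      rfl
    obtain ⟨h, hh⟩ := exists_sum_shift_sub_eq b' hb' (-P.lamp) (by
      rw [Finsupp.sum_neg_index (by simp), Finsupp.sum_neg, neg_eq_zero]
      exact hP1)
    -- In `commutator_eq` the lamps of `x` are shifted by the base of `y` and conversely, so the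
    -- bases are swapped; the second term enters with a minus sign, so `h (i, 1)` is negated.
    refine ⟨fun i => ⟨b' (i, 1), h (i, 0)⟩, fun i => ⟨b' (i, 0), -h (i, 1)⟩, 1, ?_⟩
    simp only [commutator_eq, Pi.one_apply, inv_one, one_mul, mul_one, ← hP]
    have hprod (u : Fin g → B →₀ A) :
        (List.ofFn fun i => (⟨0, u i⟩ : RestrictedWreath A B)).prod = ⟨0, ∑ i, u i⟩ := by
      have := map_list_prod (lampHom (A := A) (B := B)) (List.ofFn fun i => .ofAdd (u i))
      rw [List.map_ofFn, List.prod_ofFn, ← ofAdd_sum] at this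
      exact this.symm
    have hu : ∑ i, (shift (h (i, 0)) (b' (i, 0)) - h (i, 0) -
        (shift (-h (i, 1)) (b' (i, 1)) - -h (i, 1))) = -P.lamp := by
      rw [← hh, Fintype.sum_prod_type]
      refine Finset.sum_congr rfl fun i _ => ?_
      rw [Fin.sum_univ_two, ← shiftHom_apply (b' (i, 1)) (-h (i, 1)), map_neg, shiftHom_apply]
      abel
    rw [hprod, hu]
    ext x
    · simp [hP0]
    · simp [hP0]

/-- The high genus Diophantine problem over a wreath product of abelian groups is in `P`. -/
theorem inP_highGenusDP [AddGroup.FG A] [AddGroup.FG B] {n k : ℕ} (a : Fin n → A) (b : Fin k → B) :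
    InP (highGenusDP a b) := by
  have : Fintype (EqSymbol n k) := Fintype.ofFinite _
  -- Variables weigh nothing; a letter weighs its image in `B × A`.
  let val : EqSymbol n k → B × A
    | .letter l => ((letterValue a b l).base, (letterValue a b l).lampSum)
    | _ => 0
  have hval (E : OrientableInput n k) : (E.encode.map val).sum =
      (∑ j, (wordValue a b (E.const j)).base, ∑ j, (wordValue a b (E.const j)).lampSum) := by
    rw [OrientableInput.sum_map_encode val (fun _ => rfl) (fun _ => rfl) (fun _ => rfl)]
    have hw (w : List (WreathLetter n k)) : (w.map fun l => val (.letter l)).sum =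
        ((wordValue a b w).base, (wordValue a b w).lampSum) := by
      induction w with
      | nil => exact (congrArg (Prod.mk 0) lampSum_one).symm
      | cons l w ih =>
        rw [List.map_cons, List.sum_cons, ih]
        exact congrArg (Prod.mk _) (lampSum_mul (letterValue a b l) (wordValue a b w)).symm
    simp only [hw]
    exact Prod.ext Prod.fst_sum Prod.snd_sum
  convert inP_of_isRegular_of_sum_eq_zero _ ((OrientableInput.isRegular_range_encode (n := n)
    (k := k)).inf (Language.isRegular_le_countP EqSymbol.isX (AddGroup.rank B))) val using 1
  ext w
  constructor
  · rintro ⟨E, rfl, hg, hE⟩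
    refine ⟨⟨⟨E, rfl⟩, ?_⟩, ?_⟩
    · change AddGroup.rank B ≤ E.encode.countP EqSymbol.isX
      rw [OrientableInput.countP_isX_encode]
      rw [div_le_iff₀ two_pos, mul_comm] at hg
      exact_mod_cast hg
    · rw [hval]
      exact Prod.ext_iff.2 ((hasSolution_iff _ _ _ hg).1 hE)
  · rintro ⟨⟨⟨E, rfl⟩, hg⟩, hE⟩
    change AddGroup.rank B ≤ E.encode.countP EqSymbol.isX at hg
    rw [OrientableInput.countP_isX_encode] at hg
    have hg' : (AddGroup.rank B : ℝ) / 2 ≤ E.genus := by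
      rw [div_le_iff₀ two_pos, mul_comm]
      exact_mod_cast hg
    rw [hval] at hE
    exact ⟨E, rfl, hg', (hasSolution_iff _ _ _ hg').2 (Prod.ext_iff.1 hE)⟩

end RestrictedWreath

theorem mainTheorem4 {A : Type u} {B : Type v} [AddCommGroup A] [AddCommGroup B]
    [AddGroup.FG A] [AddGroup.FG B] :
    (∀ (n k : ℕ) (a : Fin n → A) (b : Fin k → B),
      AddSubgroup.closure (Set.range a) = ⊤ → AddSubgroup.closure (Set.range b) = ⊤ →
        InP (highGenusDP a b)) ∧
    (∀ (g m : ℕ) (c : Fin m → RestrictedWreath A B), (AddGroup.rank B : ℝ) / 2 ≤ g →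
      (HasSolution (orientableWord g c) ↔
        ∑ j, (c j).base = 0 ∧ ∑ j, (c j).lampSum = 0)) :=
  ⟨fun _ _ a b _ _ => RestrictedWreath.inP_highGenusDP a b, RestrictedWreath.hasSolution_iff⟩
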